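/- Let $B_3=\langle\sigma_1,\sigma_2\mid\sigma_1\sigma_2\sigma_1=\sigma_2\sigma_1\sigma_2\rangle$ be the braid group on three strands, let $\Delta=\sigma_1\sigma_2\sigma_1$, and let $\psi:B_3\to SL_2(\mathbb Z)$ be the homomorphism with $\psi(\sigma_1)=\begin{pmatrix}1&1\\0&1\end{pmatrix}$ and $\psi(\sigma_2)=\begin{pmatrix}1&0\\-1&1\end{pmatrix}$. A braid $\beta\in B_3$ is called reducible if $|\mathrm{tr}\,\psi(\beta)|=2$. Let $D_3$ be the disk with three punctures, with $\pi_1(D_3)$ free on loops $y_1,y_2,y_3$ around the punctures, let $\epsilon:\pi_1(D_3)\to\mathbb Z$ be the exponent sum, and let $\tilde D_3$ be the infinite cyclic cover of $D_3$ corresponding to $\ker\epsilon$. Regard $H_1(\tilde D_3)=(\ker\epsilon)^{\mathrm{ab}}$ as a module over $\Lambda=\mathbb Z[t,t^{-1}]$, where $t$ acts as the generating deck transformation, that is, by $x\mapsto y_1xy_1^{-1}$. The group $B_3$ acts on $\pi_1(D_3)$ by $$\sigma_1:\ y_1\mapsto y_2,\quad y_2\mapsto y_2y_1y_2^{-1},\quad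 y_3\mapsto y_3,\qquad\qquad \sigma_2:\ y_1\mapsto y_1,\quad y_2\mapsto y_3,\quad y_3\mapsto y_3y_2y_3^{-1}.$$ This action preserves $\epsilon$, and the induced $\Lambda$-linear action on $H_1(\tilde D_3)$ is the reduced Burau representation $\rho_r$. **Proposition.** Let $\beta\in B_3$ be reducible. Then $\beta$ can be written as $\beta=\Delta^{2k}\tau\sigma_1^m\tau^{-1}$ with $k,m\in\mathbb Z$ and $\tau\in B_3$. Moreover, $H_1(\tilde D_3)$ is a free $\Lambda$-module of rank $2$, and for every $\Lambda$-basis of it and every such expression of $\beta$, the matrix $M_r(\beta)$ of $\rho_r(\beta)$ with respect to this basis satisfies $$\mathrm{tr}(M_r(\beta))=t^{3k}+(-1)^m t^{3k+m}.$$ -/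

import Mathlib

open scoped LaurentPolynomial MatrixGroups

noncomputable section

/-! ### The braid group on three strands -/

/-- The defining relation `σ₁ σ₂ σ₁ = σ₂ σ₁ σ₂` of the braid group `B₃`, where the generator
`σᵢ₊₁` is indexed by `i : Fin 2`. -/
def braidRels : Set (FreeGroup (Fin 2)) :=
  {FreeGroup.of 0 * FreeGroup.of 1 * FreeGroup.of 0 *
    (FreeGroup.of 1 * FreeGroup.of 0 * FreeGroup.of 1)⁻¹}

/-- The braid group `B₃ = ⟨σ₁, σ₂ ∣ σ₁ σ₂ σ₁ = σ₂ σ₁ σ₂⟩`. -/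
abbrev B3 : Type := PresentedGroup braidRels

namespace B3

/-- The generator `σ₁`. -/
def σ₁ : B3 := PresentedGroup.of 0

/-- The generator `σ₂`. -/
def σ₂ : B3 := PresentedGroup.of 1

/-- The half twist `Δ = σ₁ σ₂ σ₁`. -/
def Δ : B3 := σ₁ * σ₂ * σ₁

/-- The homomorphism out of `B₃` given by two elements that satisfy the braid relation. -/
def lift {G : Type*} [Group G] (a b : G) (h : a * b * a = b * a * b) : B3 →* G :=
  PresentedGroup.toGroup (f := ![a, b]) (by
    rintro r rfl
    simp [h])

@[simp] theorem lift_σ₁ {G : Type*} [Group G] (a b : G) (h : a * b * a = b * a * b) :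
    lift a b h σ₁ = a := by
  simp [lift, σ₁]

@[simp] theorem lift_σ₂ {G : Type*} [Group G] (a b : G) (h : a * b * a = b * a * b) :
    lift a b h σ₂ = b := by
  simp [lift, σ₂]

end B3

/-! ### The map to `SL₂(ℤ)` and reducible braids -/

/-- The action on `H₁` of the torus of the positive Dehn twist that corresponds to `σ₁`. -/
def twistMatrix₁ : SL(2, ℤ) := ⟨!![1, 1; 0, 1], by simp⟩

/-- The action on `H₁` of the torus of the positive Dehn twist that corresponds to `σ₂`. -/
def twistMatrix₂ : SL(2, ℤ) := ⟨!![1, 0; -1, 1], by simp⟩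

/-- The homomorphism `ψ : B₃ → SL₂(ℤ)` that sends `σ₁` and `σ₂` to the actions on `H₁` of the
torus of positive Dehn twists about two dual curves. -/
def braidToSL2 : B3 →* SL(2, ℤ) :=
  B3.lift twistMatrix₁ twistMatrix₂ (by decide)

/-- A 3-braid is reducible if its image in `SL₂(ℤ)` has trace `2` or `-2`. -/
def IsReducibleBraid (β : B3) : Prop :=
  |Matrix.trace (braidToSL2 β : Matrix (Fin 2) (Fin 2) ℤ)| = 2

/-! ### The action on the fundamental group of the punctured disk

The fundamental group of the disk with three punctures is the free group on the loops
`y₁, y₂, y₃` around the punctures (indexed by `Fin 3`). -/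

/-- The fundamental group of the disk with three punctures. -/
abbrev PunctDiskGroup : Type := FreeGroup (Fin 3)

/-- The automorphism induced by `σ₁`: `y₁ ↦ y₂`, `y₂ ↦ y₂ y₁ y₂⁻¹`, `y₃ ↦ y₃`. -/
def artinσ₁ : MulAut PunctDiskGroup :=
  MonoidHom.toMulEquiv
    (FreeGroup.lift ![.of 1, .of 1 * .of 0 * (.of 1)⁻¹, .of 2])
    (FreeGroup.lift ![(.of 0)⁻¹ * .of 1 * .of 0, .of 0, .of 2])
    (by ext i; fin_cases i <;> simp [mul_assoc])
    (by ext i; fin_cases i <;> simp [mul_assoc])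

/-- The automorphism induced by `σ₂`: `y₁ ↦ y₁`, `y₂ ↦ y₃`, `y₃ ↦ y₃ y₂ y₃⁻¹`. -/
def artinσ₂ : MulAut PunctDiskGroup :=
  MonoidHom.toMulEquiv
    (FreeGroup.lift ![.of 0, .of 2, .of 2 * .of 1 * (.of 2)⁻¹])
    (FreeGroup.lift ![.of 0, (.of 1)⁻¹ * .of 2 * .of 1, .of 1])
    (by ext i; fin_cases i <;> simp [mul_assoc])
    (by ext i; fin_cases i <;> simp [mul_assoc])

theorem artin_braid_relation :
    artinσ₁ * artinσ₂ * artinσ₁ = artinσ₂ * artinσ₁ * artinσ₂ := by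
  apply MulEquiv.toMonoidHom_injective
  ext i
  fin_cases i <;> simp [artinσ₁, artinσ₂, mul_assoc]

/-- The action of `B₃` on the fundamental group of the punctured disk. -/
def artinAction : B3 →* MulAut PunctDiskGroup :=
  B3.lift artinσ₁ artinσ₂ artin_braid_relation

/-! ### The infinite cyclic cover and its first homology -/

/-- The exponent sum `ε : π₁(D₃) → ℤ`. -/
def expSum : PunctDiskGroup →* Multiplicative ℤ :=
  FreeGroup.lift fun _ => Multiplicative.ofAdd 1

theorem expSum_artinAction (β : B3) (w : PunctDiskGroup) :
    expSum (artinAction β w) = expSum w := by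
  have key : ∀ f : MulAut PunctDiskGroup, (∀ i, expSum (f (.of i)) = expSum (.of i)) →
      ∀ w, expSum (f w) = expSum w := by
    intro f hf w
    have : expSum.comp f.toMonoidHom = expSum := by
      ext i; simpa using congrArg Multiplicative.toAdd (hf i)
    exact DFunLike.congr_fun this w
  have h1 : ∀ w, expSum (artinσ₁ w) = expSum w := key _ fun i => by
    fin_cases i <;> simp [artinσ₁, expSum]
  have h2 : ∀ w, expSum (artinσ₂ w) = expSum w := key _ fun i => by
    fin_cases i <;> simp [artinσ₂, expSum]
  let S : Subgroup B3 :=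
    { carrier := {β | ∀ w, expSum (artinAction β w) = expSum w}
      one_mem' := by intro w; simp
      mul_mem' := by
        intro a b ha hb w
        simp only [map_mul, MulAut.mul_apply]
        rw [ha, hb]
      inv_mem' := by
        intro a ha w
        rw [← ha (artinAction a⁻¹ w), ← MulAut.mul_apply, ← map_mul]
        simp }
  have hS : β ∈ S := by
    have htop : (⊤ : Subgroup B3) ≤ S := by
      rw [← PresentedGroup.closure_range_of braidRels, Subgroup.closure_le]
      rintro _ ⟨i, rfl⟩ w
      fin_cases i
      · change expSum (artinAction B3.σ₁ w) = _
        simpa [artinAction] using h1 w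
      · change expSum (artinAction B3.σ₂ w) = _
        simpa [artinAction] using h2 w
    exact htop (Subgroup.mem_top β)
  exact hS w

/-- The fundamental group of the infinite cyclic cover of the punctured disk that corresponds
to the kernel of the exponent sum. -/
abbrev coverGroup : Subgroup PunctDiskGroup := expSum.ker

/-- The first homology of the infinite cyclic cover: the abelianization of its fundamental
group, written additively. -/
def CoverHomology : Type := Additive (Abelianization coverGroup)

instance : AddCommGroup CoverHomology :=
  inferInstanceAs (AddCommGroup (Additive (Abelianization coverGroup)))

/-- The homology class of an element of the fundamental group of the cover. -/
def homologyClass (x : coverGroup) : CoverHomology := Additive.ofMul (Abelianization.of x)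

/-- The endomorphism of the homology of the cover induced by an endomorphism of its
fundamental group. -/
def inducedOnHomology : Monoid.End coverGroup →* AddMonoid.End CoverHomology where
  toFun f := MonoidHom.toAdditive (Abelianization.map f)
  map_one' := by
    apply AddMonoidHom.ext
    intro x
    exact DFunLike.congr_fun (Abelianization.map_id (G := coverGroup)) x
  map_mul' f g := by
    apply AddMonoidHom.ext
    intro x
    exact (Abelianization.map_map_apply (f := g) (g := f) (x := x)).symm

@[simp] theorem inducedOnHomology_homologyClass (f : Monoid.End coverGroup) (x : coverGroup) :
    inducedOnHomology f (homologyClass x) = homologyClass (f x) := rfl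

theorem homologyClass_surjective : Function.Surjective homologyClass := by
  intro x
  obtain ⟨y, hy⟩ := QuotientGroup.mk_surjective (Additive.toMul x : Abelianization coverGroup)
  exact ⟨y, hy⟩

theorem homologyClass_conj (c x : coverGroup) :
    homologyClass (c * x * c⁻¹) = homologyClass x := by
  unfold homologyClass
  congr 1
  simp

/-- The conjugation action of the fundamental group of the punctured disk on that of the cover. -/
def conjOnCover : PunctDiskGroup →* Monoid.End coverGroup where
  toFun y := (MulAut.conjNormal y : MulAut coverGroup).toMonoidHom
  map_one' := by
    apply MonoidHom.ext; intro x
    change (MulAut.conjNormal (1 : PunctDiskGroup) : MulAut coverGroup) x = x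
    simp
  map_mul' a b := by
    apply MonoidHom.ext; intro x
    change (MulAut.conjNormal (a * b) : MulAut coverGroup) x =
      (MulAut.conjNormal a : MulAut coverGroup) ((MulAut.conjNormal b : MulAut coverGroup) x)
    simp

/-- The action of the deck group `ℤ = ⟨t⟩` on the homology of the cover. A loop `y` of exponent
sum `1` lifts to a path from the base point to its translate by `t`, so `t` acts by the
conjugation `x ↦ y x y⁻¹`; here `y = y₁`. -/
def deckAction : Multiplicative ℤ →* AddMonoid.End CoverHomology :=
  inducedOnHomology.comp (conjOnCover.comp (zpowersHom PunctDiskGroup (.of 0)))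

theorem deckAction_homologyClass (n : ℤ) (x : coverGroup) :
    deckAction (Multiplicative.ofAdd n) (homologyClass x) =
      homologyClass (MulAut.conjNormal ((FreeGroup.of 0 : PunctDiskGroup) ^ n) x) := rfl

/-- The `ℤ[t, t⁻¹]`-module structure on the homology of the cover in which `t` acts as the
generating deck transformation. -/
instance : Module ℤ[T;T⁻¹] CoverHomology :=
  Module.compHom CoverHomology
    (AddMonoidAlgebra.liftNCRingHom (Int.castRingHom (AddMonoid.End CoverHomology)) deckAction
      (fun a b => Int.cast_commute a (deckAction b)))

theorem T_smul (n : ℤ) (x : CoverHomology) :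
    (LaurentPolynomial.T n : ℤ[T;T⁻¹]) • x = deckAction (Multiplicative.ofAdd n) x := by
  change (AddMonoidAlgebra.liftNCRingHom (Int.castRingHom (AddMonoid.End CoverHomology))
    deckAction (fun a b => Int.cast_commute a (deckAction b)) (LaurentPolynomial.T n : ℤ[T;T⁻¹])) x = _
  rw [LaurentPolynomial.T]
  erw [AddMonoidAlgebra.liftNCRingHom_single]
  simp

/-! ### The reduced Burau representation -/

/-- The lift of a braid to the cover, acting on the fundamental group of the cover. -/
def liftToCover : B3 →* Monoid.End coverGroup where
  toFun β := ((artinAction β).toMonoidHom.comp coverGroup.subtype).codRestrict coverGroup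
    (fun x => by
      rw [MonoidHom.mem_ker]
      exact (expSum_artinAction β x).trans x.2)
  map_one' := by
    apply MonoidHom.ext; intro x; apply Subtype.ext
    change artinAction 1 (x : PunctDiskGroup) = x
    simp
  map_mul' a b := by
    apply MonoidHom.ext; intro x; apply Subtype.ext
    change artinAction (a * b) (x : PunctDiskGroup) = artinAction a (artinAction b x)
    simp

@[simp] theorem coe_liftToCover (β : B3) (x : coverGroup) :
    (liftToCover β x : PunctDiskGroup) = artinAction β x := rfl

theorem liftToCover_deckAction (β : B3) (n : ℤ) (x : CoverHomology) :
    inducedOnHomology (liftToCover β) (deckAction (Multiplicative.ofAdd n) x) =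
      deckAction (Multiplicative.ofAdd n) (inducedOnHomology (liftToCover β) x) := by
  obtain ⟨x, rfl⟩ := homologyClass_surjective x
  set y : PunctDiskGroup := (FreeGroup.of 0) ^ n with hy
  let c : coverGroup := ⟨artinAction β y * y⁻¹, by
    rw [MonoidHom.mem_ker, map_mul, expSum_artinAction, ← map_mul, mul_inv_cancel, map_one]⟩
  rw [deckAction_homologyClass, inducedOnHomology_homologyClass,
    inducedOnHomology_homologyClass, deckAction_homologyClass,
    ← homologyClass_conj c (MulAut.conjNormal y (liftToCover β x))]
  congr 1
  apply Subtype.ext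
  simp [c, ← hy, mul_assoc]

theorem inducedOnHomology_smul (β : B3) (p : ℤ[T;T⁻¹]) (x : CoverHomology) :
    inducedOnHomology (liftToCover β) (p • x) = p • inducedOnHomology (liftToCover β) x := by
  induction p using LaurentPolynomial.induction_on' with
  | add p q hp hq => rw [add_smul, add_smul, map_add, hp, hq]
  | C_mul_T n a =>
    have hC : (LaurentPolynomial.C a : ℤ[T;T⁻¹]) = ((a : ℤ) : ℤ[T;T⁻¹]) := by simp
    rw [mul_smul, mul_smul, T_smul, T_smul, hC, Int.cast_smul_eq_zsmul, Int.cast_smul_eq_zsmul,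
      map_zsmul, liftToCover_deckAction]

/-- The reduced Burau representation: the `ℤ[t, t⁻¹]`-linear action of `B₃` on the first
homology of the infinite cyclic cover of the punctured disk. -/
def reducedBurau : B3 →* Module.End ℤ[T;T⁻¹] CoverHomology where
  toFun β :=
    { toFun := inducedOnHomology (liftToCover β)
      map_add' := map_add _
      map_smul' := inducedOnHomology_smul β }
  map_one' := by
    apply LinearMap.ext; intro x
    change inducedOnHomology (liftToCover 1) x = x
    simp
  map_mul' a b := by
    apply LinearMap.ext; intro x
    change inducedOnHomology (liftToCover (a * b)) x =
      inducedOnHomology (liftToCover a) (inducedOnHomology (liftToCover b) x)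
    simp

/-- The reduced Burau matrix `M_r(β)` with respect to a basis `b` of the first homology of the
infinite cyclic cover. -/
def reducedBurauMatrix (b : Module.Basis (Fin 2) ℤ[T;T⁻¹] CoverHomology) (β : B3) :
    Matrix (Fin 2) (Fin 2) ℤ[T;T⁻¹] :=
  LinearMap.toMatrix b b (reducedBurau β)

end

/-! ### Reducible braids up to conjugation -/

noncomputable section

namespace B3

/-! Existence is the statement that modulo the central full twist `B3` is generated by an element
`Δ` of order two and an element `rot` of order three. An alternating word in these, reduced
cyclically, leaves `Δ`, `rot ^ ±1` or a product of letters `σ₁` and `σ₂⁻¹` (`hasCore`). The first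
two kinds have trace 0 or ±1 in `SL(2, ℤ)`. The products give nonnegative matrices, and trace 2 with
determinant 1 makes them triangular, hence powers of `σ₁` or of `σ₂⁻¹` (`eq_replicate_of_trace`).

For the homology, the crossed homomorphism `crossedClass` shows that two loop classes span, and Fox
derivatives show that they are independent.

The trace is invariant under conjugation and change of basis. The full twist acts on π₁ as
conjugation by a loop of exponent sum 3, so by the scalar `t³` (`reducedBurau_Δ_sq`), and `σ₁` is
triangular with diagonal `-t, 1` (`trace_reducedBurau_σ₁_zpow`). -/

theorem braid_relation : σ₁ * σ₂ * σ₁ = σ₂ * σ₁ * σ₂ := by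
  have h : (PresentedGroup.mk braidRels) (FreeGroup.of 0 * FreeGroup.of 1 * FreeGroup.of 0 *
    (FreeGroup.of 1 * FreeGroup.of 0 * FreeGroup.of 1)⁻¹) = 1 :=
    PresentedGroup.one_of_mem (by simp [braidRels])
  simp only [map_mul, map_inv] at h
  exact mul_inv_eq_one.1 h

theorem closure_generators : Subgroup.closure {σ₁, σ₂} = ⊤ := by
  rw [← PresentedGroup.closure_range_of braidRels]
  congr 1
  ext x
  simp only [Set.mem_insert_iff, Set.mem_singleton_iff, Set.mem_range, Fin.exists_fin_two]
  exact or_congr eq_comm eq_comm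

/-- The full twist `Δ²`. -/
def fullTwist : B3 := Δ ^ 2

/-- The element `σ₁ σ₂`, a cube root of the full twist. -/
def rot : B3 := σ₁ * σ₂

theorem Δ_mul_Δ : Δ * Δ = fullTwist := (pow_two Δ).symm

theorem Δ_eq_rot_mul : Δ = rot * σ₁ := rfl

theorem Δ_eq_mul_rot : Δ = σ₂ * rot := by
  rw [Δ, rot, braid_relation, mul_assoc]

theorem rot_pow_three : rot * rot * rot = fullTwist := by
  rw [← Δ_mul_Δ]
  nth_rewrite 2 [Δ_eq_mul_rot]
  rw [Δ_eq_rot_mul]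
  simp only [rot, mul_assoc]

/-- The full twist is a power of `Δ` and also of `rot`, so it commutes with both, and these generate
the group. -/
theorem commute_fullTwist (β : B3) : Commute fullTwist β := by
  have hΔ : Commute fullTwist Δ := (Commute.refl Δ).pow_left 2
  have hr : Commute fullTwist rot := by
    rw [← rot_pow_three]
    exact ((Commute.refl rot).mul_left (Commute.refl rot)).mul_left (Commute.refl rot)
  have h1 : Commute fullTwist σ₁ := by
    have : σ₁ = rot⁻¹ * Δ := by rw [Δ_eq_rot_mul]; group
    rw [this]; exact hr.inv_right.mul_right hΔ
  have h2 : Commute fullTwist σ₂ := by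
    have : σ₂ = Δ * rot⁻¹ := by rw [Δ_eq_mul_rot]; group
    rw [this]; exact hΔ.mul_right hr.inv_right
  have hle : Subgroup.closure {σ₁, σ₂} ≤ Subgroup.centralizer {fullTwist} := by
    rw [Subgroup.closure_le]
    rintro x (rfl | rfl) <;> simp only [SetLike.mem_coe, Subgroup.mem_centralizer_singleton_iff]
    · exact h1.eq.symm
    · exact h2.eq.symm
  rw [closure_generators] at hle
  exact (Subgroup.mem_centralizer_singleton_iff.1 (hle (Subgroup.mem_top β))).symm

/-! ### Alternating words and normal forms -/

/-- The product of a word in the letters `σ₁` (for `true`) and `σ₂⁻¹` (for `false`). -/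
def altWord (w : List Bool) : B3 := (w.map fun s => cond s σ₁ σ₂⁻¹).prod

@[simp] theorem altWord_nil : altWord [] = 1 := rfl

@[simp] theorem altWord_cons (s : Bool) (w : List Bool) :
    altWord (s :: w) = cond s σ₁ σ₂⁻¹ * altWord w := by
  simp [altWord]

theorem altWord_append (v w : List Bool) : altWord (v ++ w) = altWord v * altWord w := by
  simp [altWord]


theorem σ₁_eq : σ₁ = rot⁻¹ * Δ := by rw [Δ_eq_rot_mul]; group

theorem inv_σ₂_eq : σ₂⁻¹ = rot * Δ⁻¹ := by rw [Δ_eq_mul_rot]; group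

theorem rot_mul_rot : rot * rot = fullTwist * rot⁻¹ := by rw [← rot_pow_three]; group

theorem Δ_inv : Δ⁻¹ = fullTwist⁻¹ * Δ := by rw [← Δ_mul_Δ]; group

theorem rot_mul_inv_σ₂ : rot * σ₂⁻¹ = σ₁ := by
  rw [inv_σ₂_eq, σ₁_eq, ← mul_assoc, rot_mul_rot, Δ_inv, mul_assoc,
    ← (commute_fullTwist rot⁻¹).inv_left.left_comm, mul_inv_cancel_left]

theorem closure_Δ_rot : Subgroup.closure {Δ, rot} = ⊤ := by
  rw [eq_top_iff, ← closure_generators, Subgroup.closure_le]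
  have ha : Δ ∈ Subgroup.closure {Δ, rot} := Subgroup.subset_closure (by simp)
  have hb : rot ∈ Subgroup.closure {Δ, rot} := Subgroup.subset_closure (by simp)
  rintro x (rfl | rfl)
  · rw [σ₁_eq]; exact mul_mem (inv_mem hb) ha
  · have : σ₂ = Δ * rot⁻¹ := by rw [Δ_eq_mul_rot]; group
    rw [this]; exact mul_mem ha (inv_mem hb)

/-- Every braid is, up to full twists, an alternating product of `Δ` and `rot ^ ±1`. -/
theorem exists_normalForm (β : B3) : ∃ (k : ℤ) (f e : B3) (w : List Bool),
    (f = 1 ∨ f = Δ) ∧ (e = 1 ∨ e = rot ∨ e = rot⁻¹) ∧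
      β = fullTwist ^ k * (f * altWord w * e) := by
  -- The free exponent `j` also covers left multiplication by inverses: `Δ⁻¹` is `Δ`, and `rot⁻¹` is
  -- `rot * rot`, times `fullTwist⁻¹`.
  have hΔ : ∀ β : B3, (∃ (k : ℤ) (f e : B3) (w : List Bool),
      (f = 1 ∨ f = Δ) ∧ (e = 1 ∨ e = rot ∨ e = rot⁻¹) ∧
        β = fullTwist ^ k * (f * altWord w * e)) → ∀ j : ℤ, ∃ (k : ℤ) (f e : B3) (w : List Bool),
      (f = 1 ∨ f = Δ) ∧ (e = 1 ∨ e = rot ∨ e = rot⁻¹) ∧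
        fullTwist ^ j * (Δ * β) = fullTwist ^ k * (f * altWord w * e) := by
    rintro β ⟨k, f, e, w, rfl | rfl, he, rfl⟩ j
    · refine ⟨j + k, Δ, e, w, .inr rfl, he, ?_⟩
      rw [((commute_fullTwist Δ).zpow_left k).symm.left_comm, zpow_add]
      group
    · refine ⟨j + k + 1, 1, e, w, .inl rfl, he, ?_⟩
      rw [((commute_fullTwist Δ).zpow_left k).symm.left_comm, zpow_add, zpow_add, zpow_one,
        ← Δ_mul_Δ]
      group
  have hrot : ∀ β : B3, (∃ (k : ℤ) (f e : B3) (w : List Bool),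
      (f = 1 ∨ f = Δ) ∧ (e = 1 ∨ e = rot ∨ e = rot⁻¹) ∧
        β = fullTwist ^ k * (f * altWord w * e)) → ∀ j : ℤ, ∃ (k : ℤ) (f e : B3) (w : List Bool),
      (f = 1 ∨ f = Δ) ∧ (e = 1 ∨ e = rot ∨ e = rot⁻¹) ∧
        fullTwist ^ j * (rot * β) = fullTwist ^ k * (f * altWord w * e) := by
    rintro β ⟨k, f, e, w, hf, he, rfl⟩ j
    rw [((commute_fullTwist rot).zpow_left k).symm.left_comm, ← mul_assoc, ← zpow_add]
    obtain rfl | rfl := hf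
    · match w with
      | [] =>
        obtain rfl | rfl | rfl := he
        · exact ⟨j + k, 1, rot, [], .inl rfl, .inr (.inl rfl), by simp⟩
        · refine ⟨j + k + 1, 1, rot⁻¹, [], .inl rfl, .inr (.inr rfl), ?_⟩
          simp only [altWord_nil, one_mul, rot_mul_rot, zpow_add_one, mul_assoc]
        · exact ⟨j + k, 1, 1, [], .inl rfl, .inl rfl, by simp⟩
      | true :: w =>
        refine ⟨j + k, Δ, e, w, .inr rfl, he, ?_⟩
        rw [altWord_cons, cond_true, σ₁_eq]
        group
      | false :: w =>
        refine ⟨j + k, 1, e, true :: w, .inl rfl, he, ?_⟩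
        simp only [altWord_cons, cond_true, cond_false, one_mul, ← rot_mul_inv_σ₂, mul_assoc]
    -- Here `rot * Δ = fullTwist * σ₂⁻¹` produces a new letter.
    · refine ⟨j + k + 1, 1, e, false :: w, .inl rfl, he, ?_⟩
      simp only [altWord_cons, cond_false, inv_σ₂_eq, Δ_inv, zpow_add_one, one_mul, mul_assoc]
      rw [((commute_fullTwist rot).inv_left).symm.left_comm, mul_inv_cancel_left]
  have hmem : β ∈ Subgroup.closure {Δ, rot} := by rw [closure_Δ_rot]; exact Subgroup.mem_top β
  induction hmem using Subgroup.closure_induction_left with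
  | one => exact ⟨0, 1, 1, [], .inl rfl, .inl rfl, by simp⟩
  | mul_left x hx y _ ih =>
    obtain rfl | rfl := hx
    · simpa using hΔ y ih 0
    · simpa using hrot y ih 0
  | inv_mul_cancel x hx y _ ih =>
    obtain rfl | rfl := hx
    · have := hΔ y ih (-1)
      rwa [zpow_neg_one, ← mul_assoc, ← Δ_inv] at this
    · have := hrot _ (by simpa using hrot y ih 0) (-1)
      rwa [← mul_assoc rot, rot_mul_rot, zpow_neg_one, mul_assoc, inv_mul_cancel_left] at this

/-! ### Cyclic reduction -/

/-- Up to full twists, a braid is conjugate to `Δ`, `rot ^ ±1` or a word in `σ₁` and `σ₂⁻¹`. -/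
def HasCore (β : B3) : Prop :=
  ∃ (k : ℤ) (τ γ : B3), (γ = Δ ∨ γ = rot ∨ γ = rot⁻¹ ∨ ∃ w, γ = altWord w) ∧
    β = fullTwist ^ k * (τ * γ * τ⁻¹)

theorem HasCore.zpow_mul {β : B3} (h : HasCore β) (j : ℤ) : HasCore (fullTwist ^ j * β) := by
  obtain ⟨k, τ, γ, hγ, rfl⟩ := h
  exact ⟨j + k, τ, γ, hγ, by simp only [zpow_add, mul_assoc]⟩

theorem HasCore.conj {β : B3} (h : HasCore β) (g : B3) : HasCore (g * β * g⁻¹) := by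
  obtain ⟨k, τ, γ, hγ, rfl⟩ := h
  refine ⟨k, g * τ, γ, hγ, ?_⟩
  rw [((commute_fullTwist g).zpow_left k).symm.left_comm]
  group

theorem HasCore.of_mul_comm {β γ : B3} (h : HasCore (β * γ)) : HasCore (γ * β) := by
  simpa [mul_assoc] using h.conj γ

theorem hasCore_altWord (w : List Bool) : HasCore (altWord w) :=
  ⟨0, 1, _, .inr (.inr (.inr ⟨w, rfl⟩)), by simp⟩

/-- Conjugation moves the extra factor to the other end of the word. There it either merges with the
adjacent letter, leaving a shorter word with another extra factor, or exchanges `σ₁` and `σ₂⁻¹` and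
disappears. The three claims feed each other, hence the joint induction. -/
theorem hasCore_aux (n : ℕ) : ∀ w : List Bool, w.length = n →
    HasCore (Δ * altWord w) ∧ HasCore (altWord w * rot) ∧ HasCore (altWord w * rot⁻¹) := by
  induction n with
  | zero =>
    intro w hw
    obtain rfl := List.length_eq_zero_iff.1 hw
    exact ⟨⟨0, 1, _, .inl rfl, by simp⟩, ⟨0, 1, _, .inr (.inl rfl), by simp⟩,
      ⟨0, 1, _, .inr (.inr (.inl rfl)), by simp⟩⟩
  | succ n ih =>
    intro w hw
    refine ⟨?_, ?_⟩
    · obtain rfl | ⟨v, s, rfl⟩ := w.eq_nil_or_concat'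
      · simp at hw
      obtain ⟨-, h2, h3⟩ := ih v (by simpa using hw)
      cases s
      · convert h2.conj Δ using 1
        simp [altWord_append, inv_σ₂_eq, mul_assoc]
      · convert (h3.conj Δ).zpow_mul 1 using 1
        simp only [altWord_append, altWord_cons, cond_true, σ₁_eq, altWord_nil, mul_one, Δ_inv,
          zpow_one, mul_assoc]
        simp only [((commute_fullTwist _).inv_left).symm.left_comm, inv_mul_cancel_left]
    · obtain _ | ⟨s, v⟩ := w
      · simp at hw
      obtain ⟨h1, -, -⟩ := ih v (by simpa using hw)
      cases s
      · refine ⟨HasCore.of_mul_comm ?_, HasCore.of_mul_comm ?_⟩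
        · convert hasCore_altWord (true :: v) using 1
          simp only [altWord_cons, cond_true, cond_false, ← rot_mul_inv_σ₂, mul_assoc]
        · convert h1.zpow_mul (-1) using 1
          simp [inv_σ₂_eq, Δ_inv, mul_assoc]
      · refine ⟨HasCore.of_mul_comm ?_, HasCore.of_mul_comm ?_⟩
        · convert h1 using 1
          simp [σ₁_eq, mul_assoc]
        · convert hasCore_altWord (false :: v) using 1
          simp only [altWord_cons, cond_true, cond_false, ← rot_mul_inv_σ₂, mul_assoc,
            inv_mul_cancel_left]

theorem hasCore (β : B3) : HasCore β := by
  obtain ⟨k, f, e, w, hf, he, rfl⟩ := exists_normalForm β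
  apply HasCore.zpow_mul
  obtain ⟨h1, h2, h3⟩ := hasCore_aux _ w rfl
  obtain rfl | rfl := hf
  · obtain rfl | rfl | rfl := he
    · simpa using hasCore_altWord w
    · simpa using h2
    · simpa using h3
  · obtain rfl | rfl | rfl := he
    · simpa using h1
    -- With factors at both ends, rotating `e` to the front makes `e * Δ` a single letter, up to a
    -- full twist.
    · apply HasCore.of_mul_comm
      convert (hasCore_altWord (false :: w)).zpow_mul 1 using 1
      rw [altWord_cons, cond_false, inv_σ₂_eq, Δ_inv,
        ((commute_fullTwist rot).inv_left).symm.left_comm]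
      group
    · apply HasCore.of_mul_comm
      convert hasCore_altWord (true :: w) using 1
      simp [σ₁_eq, mul_assoc]


/-! ### Traces -/

theorem altWord_replicate_true (n : ℕ) : altWord (List.replicate n true) = σ₁ ^ n := by
  simp [altWord]

theorem altWord_replicate_false (n : ℕ) : altWord (List.replicate n false) = σ₂⁻¹ ^ n := by
  simp [altWord]

theorem braidToSL2_σ₁ : (braidToSL2 σ₁ : Matrix (Fin 2) (Fin 2) ℤ) = !![1, 1; 0, 1] := by
  rw [braidToSL2, lift_σ₁]; rfl

theorem braidToSL2_σ₂ : (braidToSL2 σ₂ : Matrix (Fin 2) (Fin 2) ℤ) = !![1, 0; -1, 1] := by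
  rw [braidToSL2, lift_σ₂]; rfl

theorem braidToSL2_inv_σ₂ : (braidToSL2 σ₂⁻¹ : Matrix (Fin 2) (Fin 2) ℤ) = !![1, 0; 1, 1] := by
  rw [map_inv, Matrix.SpecialLinearGroup.coe_inv, braidToSL2_σ₂]
  simp [Matrix.adjugate_fin_two]

theorem braidToSL2_rot : (braidToSL2 rot : Matrix (Fin 2) (Fin 2) ℤ) = !![0, 1; -1, 1] := by
  simp [rot, braidToSL2_σ₁, braidToSL2_σ₂]

theorem braidToSL2_Δ : (braidToSL2 Δ : Matrix (Fin 2) (Fin 2) ℤ) = !![0, 1; -1, 0] := by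
  simp [Δ, braidToSL2_σ₁, braidToSL2_σ₂]

theorem braidToSL2_fullTwist : braidToSL2 fullTwist = -1 := by
  apply Subtype.ext
  rw [fullTwist, map_pow, Matrix.SpecialLinearGroup.coe_pow, braidToSL2_Δ, pow_two]
  ext i j
  fin_cases i <;> fin_cases j <;> simp

/-- The matrix of a word in `σ₁` and `σ₂⁻¹` is nonnegative with positive diagonal, and is
triangular only if the word is constant. -/
theorem braidToSL2_altWord (w : List Bool) :
    ∃ x y z v : ℤ, (braidToSL2 (altWord w) : Matrix (Fin 2) (Fin 2) ℤ) = !![x, y; z, v] ∧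
      1 ≤ x ∧ 0 ≤ y ∧ 0 ≤ z ∧ 1 ≤ v ∧
      (y = 0 → w = List.replicate w.length false) ∧
      (z = 0 → w = List.replicate w.length true) := by
  induction w with
  | nil => exact ⟨1, 0, 0, 1, by simp [Matrix.one_fin_two], by simp⟩
  | cons s w ih =>
    obtain ⟨x, y, z, v, h, hx, hy, hz, hv, hy0, hz0⟩ := ih
    rw [altWord_cons, map_mul, Matrix.SpecialLinearGroup.coe_mul, h]
    cases s
    · refine ⟨x, y, x + z, y + v, ?_, hx, hy, by omega, by omega, fun h0 => ?_, by omega⟩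
      · rw [cond_false, braidToSL2_inv_σ₂]; simp
      · rw [List.length_cons, List.replicate_succ, ← hy0 h0]
    · refine ⟨x + z, y + v, z, v, ?_, by omega, by omega, hz, hv, by omega, fun h0 => ?_⟩
      · rw [cond_true, braidToSL2_σ₁]; simp
      · rw [List.length_cons, List.replicate_succ, ← hz0 h0]

/-- Diagonal entries at least 1 with sum 2 are both 1, and determinant 1 then forces one
off-diagonal entry to vanish. -/
theorem eq_replicate_of_trace {w : List Bool}
    (h : |Matrix.trace (braidToSL2 (altWord w) : Matrix (Fin 2) (Fin 2) ℤ)| = 2) :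
    w = List.replicate w.length false ∨ w = List.replicate w.length true := by
  obtain ⟨x, y, z, v, hm, hx, hy, hz, hv, hy0, hz0⟩ := braidToSL2_altWord w
  have hdet := (braidToSL2 (altWord w)).det_coe
  rw [hm, Matrix.det_fin_two_of] at hdet
  rw [hm, Matrix.trace_fin_two_of, abs_of_nonneg (by omega)] at h
  obtain rfl : x = 1 := by omega
  obtain rfl : v = 1 := by omega
  have h0 : y * z = 0 := by linarith
  exact (mul_eq_zero.1 h0).imp hy0 hz0

theorem abs_trace_fullTwist_zpow_mul (k : ℤ) (β : B3) :
    |Matrix.trace (braidToSL2 (fullTwist ^ k * β) : Matrix (Fin 2) (Fin 2) ℤ)| =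
      |Matrix.trace (braidToSL2 β : Matrix (Fin 2) (Fin 2) ℤ)| := by
  rw [map_mul, map_zpow, braidToSL2_fullTwist]
  obtain h | h := Int.even_or_odd k
  · simp [h.neg_one_zpow]
  · simp [h.neg_one_zpow]

theorem trace_conj (τ β : B3) :
    Matrix.trace (braidToSL2 (τ * β * τ⁻¹) : Matrix (Fin 2) (Fin 2) ℤ) =
      Matrix.trace (braidToSL2 β : Matrix (Fin 2) (Fin 2) ℤ) := by
  rw [map_mul, Matrix.SpecialLinearGroup.coe_mul, Matrix.trace_mul_comm,
    ← Matrix.SpecialLinearGroup.coe_mul, ← map_mul]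
  simp

/-- Both `rot * σ₁` and `σ₂ * rot` equal `Δ`. This turns powers of `σ₂⁻¹` into conjugates of
negative powers of `σ₁`. -/
theorem inv_σ₂_eq_conj : σ₂⁻¹ = rot * σ₁⁻¹ * rot⁻¹ := by
  have : rot * σ₁ = σ₂ * rot := by rw [← Δ_eq_rot_mul, Δ_eq_mul_rot]
  rw [inv_eq_iff_eq_inv, eq_mul_inv_of_mul_eq this.symm]
  group

theorem exists_eq_of_isReducible {β : B3} (hβ : IsReducibleBraid β) :
    ∃ (k m : ℤ) (τ : B3), β = Δ ^ (2 * k) * τ * σ₁ ^ m * τ⁻¹ := by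
  obtain ⟨k, τ, γ, hγ, rfl⟩ := hasCore β
  have hk : Δ ^ (2 * k) = fullTwist ^ k := by rw [zpow_mul, fullTwist]; rfl
  rw [IsReducibleBraid, abs_trace_fullTwist_zpow_mul, trace_conj] at hβ
  obtain rfl | rfl | rfl | ⟨w, rfl⟩ := hγ
  · simp [braidToSL2_Δ, Matrix.trace_fin_two] at hβ
  · simp [braidToSL2_rot, Matrix.trace_fin_two] at hβ
  · rw [map_inv, Matrix.SpecialLinearGroup.coe_inv, braidToSL2_rot] at hβ
    simp [Matrix.adjugate_fin_two, Matrix.trace_fin_two] at hβ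
  · obtain h | h := eq_replicate_of_trace hβ
    · refine ⟨k, -w.length, τ * rot, ?_⟩
      rw [h, altWord_replicate_false, inv_σ₂_eq_conj, conj_pow, hk]
      simp [mul_assoc]
    · refine ⟨k, w.length, τ, ?_⟩
      rw [h, altWord_replicate_true, hk]
      simp [mul_assoc]

end B3

/-! ### A basis of the homology of the cover -/

theorem homologyClass_mul (x y : coverGroup) :
    homologyClass (x * y) = homologyClass x + homologyClass y := rfl

theorem expSum_of (i : Fin 3) : expSum (.of i) = Multiplicative.ofAdd 1 := by
  simp [expSum]

/-- Conjugation by a loop acts on the homology of the cover through its exponent sum. -/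
theorem homologyClass_conjNormal (g : PunctDiskGroup) (x : coverGroup) :
    homologyClass (MulAut.conjNormal g x) =
      (LaurentPolynomial.T (Multiplicative.toAdd (expSum g)) : ℤ[T;T⁻¹]) • homologyClass x := by
  rw [T_smul, deckAction_homologyClass]
  set y : PunctDiskGroup := (FreeGroup.of 0) ^ (Multiplicative.toAdd (expSum g)) with hy
  let c : coverGroup := ⟨g * y⁻¹, by
    rw [MonoidHom.mem_ker, map_mul, map_inv, hy, map_zpow, expSum_of, ← ofAdd_zsmul]
    simp⟩
  rw [← homologyClass_conj c (MulAut.conjNormal y x)]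
  congr 1
  apply Subtype.ext
  simp [c, mul_assoc]

/-- The loop `g y₁⁻ⁿ` in the cover, where `n` is the exponent sum of `g`. -/
def normalizedLoop (g : PunctDiskGroup) : coverGroup :=
  ⟨g * ((FreeGroup.of 0) ^ (Multiplicative.toAdd (expSum g)))⁻¹, by
    rw [MonoidHom.mem_ker, map_mul, map_inv, map_zpow, expSum_of, ← ofAdd_zsmul]
    simp⟩

/-- The crossed homomorphism `g ↦ [g y₁⁻ⁿ]`. -/
def crossedClass (g : PunctDiskGroup) : CoverHomology := homologyClass (normalizedLoop g)

/-- With `m`, `n` the exponent sums of `g`, `h`, the loop `g h y₁^(-m-n)` is `g y₁^(-m)` times the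
conjugate of `h y₁^(-n)` by `y₁^m`, and that conjugation is `t^m`. -/
theorem crossedClass_mul (g h : PunctDiskGroup) :
    crossedClass (g * h) = crossedClass g +
      (LaurentPolynomial.T (Multiplicative.toAdd (expSum g)) : ℤ[T;T⁻¹]) • crossedClass h := by
  rw [crossedClass, crossedClass, crossedClass, T_smul, deckAction_homologyClass,
    ← homologyClass_mul]
  congr 1
  apply Subtype.ext
  simp only [normalizedLoop, Subgroup.coe_mul, MulAut.conjNormal_apply, map_mul, toAdd_mul, zpow_add]
  group

theorem crossedClass_coe (x : coverGroup) :
    crossedClass (x : PunctDiskGroup) = homologyClass x := by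
  rw [crossedClass]
  congr 1
  apply Subtype.ext
  have : expSum (x : PunctDiskGroup) = 1 := x.2
  simp [normalizedLoop, this]

theorem crossedClass_one : crossedClass 1 = 0 := by
  simpa using crossedClass_mul 1 1

theorem crossedClass_inv (g : PunctDiskGroup) :
    crossedClass g⁻¹ =
      -((LaurentPolynomial.T (-Multiplicative.toAdd (expSum g)) : ℤ[T;T⁻¹]) • crossedClass g) := by
  have h := crossedClass_mul g⁻¹ g
  rw [inv_mul_cancel, crossedClass_one, map_inv, toAdd_inv] at h
  exact eq_neg_of_add_eq_zero_left h.symm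

theorem crossedClass_of_zero : crossedClass (.of 0) = 0 := by
  rw [crossedClass, ← crossedClass_coe, ← crossedClass_one]
  congr 1
  simp [normalizedLoop, expSum_of]

/-- The generators `[y₂ y₁⁻¹]` and `[y₃ y₁⁻¹]` of the homology of the cover. -/
def loopClass (i : Fin 2) : CoverHomology := crossedClass (.of i.succ)

theorem span_loopClass : Submodule.span ℤ[T;T⁻¹] (Set.range loopClass) = ⊤ := by
  rw [eq_top_iff]
  rintro x -
  obtain ⟨x, rfl⟩ := homologyClass_surjective x
  rw [← crossedClass_coe]
  -- Passing to an arbitrary element of the free group permits induction on words, whose prefixes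
  -- leave the kernel of `expSum`.
  generalize (x : PunctDiskGroup) = g
  induction g using FreeGroup.induction_on with
  | C1 => rw [crossedClass_one]; exact zero_mem _
  | of i =>
    refine Fin.cases ?_ (fun i => ?_) i
    · change crossedClass (.of 0) ∈ _
      rw [crossedClass_of_zero]; exact zero_mem _
    · exact Submodule.subset_span ⟨i, rfl⟩
  | inv_of i h =>
    change crossedClass (FreeGroup.of i)⁻¹ ∈ _
    rw [crossedClass_inv]
    exact neg_mem (Submodule.smul_mem _ _ h)
  | mul g h hg hh =>
    rw [crossedClass_mul]
    exact add_mem hg (Submodule.smul_mem _ _ hh)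

/-! ### Independence through Fox derivatives -/

/-- Multiplication by powers of `t` on the free module of rank two. -/
def shiftAction : Multiplicative ℤ →* MulAut (Multiplicative (Fin 2 → ℤ[T;T⁻¹])) where
  toFun n := AddEquiv.toMultiplicative
    { toFun := fun v => (LaurentPolynomial.T (Multiplicative.toAdd n) : ℤ[T;T⁻¹]) • v
      invFun := fun v => (LaurentPolynomial.T (-Multiplicative.toAdd n) : ℤ[T;T⁻¹]) • v
      left_inv := fun v => by
        change _ • _ • v = v
        rw [smul_smul, ← LaurentPolynomial.T_add, neg_add_cancel, LaurentPolynomial.T_zero,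
          one_smul]
      right_inv := fun v => by
        change _ • _ • v = v
        rw [smul_smul, ← LaurentPolynomial.T_add, add_neg_cancel, LaurentPolynomial.T_zero,
          one_smul]
      map_add' := smul_add _ }
  map_one' := by
    ext v : 1
    change Multiplicative.ofAdd ((LaurentPolynomial.T 0 : ℤ[T;T⁻¹]) • v.toAdd) = v
    rw [LaurentPolynomial.T_zero, one_smul]; rfl
  map_mul' m n := by
    ext v : 1
    change Multiplicative.ofAdd
        ((LaurentPolynomial.T (m.toAdd + n.toAdd) : ℤ[T;T⁻¹]) • v.toAdd) =
      Multiplicative.ofAdd ((LaurentPolynomial.T m.toAdd : ℤ[T;T⁻¹]) •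
        (LaurentPolynomial.T n.toAdd : ℤ[T;T⁻¹]) • v.toAdd)
    rw [LaurentPolynomial.T_add, mul_smul]

/-- The Magnus representation: the free group acts on the free module of rank two by affine maps
whose translation parts are the Fox derivatives with respect to `y₂` and `y₃`. -/
def magnus : PunctDiskGroup →*
    Multiplicative (Fin 2 → ℤ[T;T⁻¹]) ⋊[shiftAction] Multiplicative ℤ :=
  FreeGroup.lift fun i =>
    ⟨.ofAdd (Fin.cases 0 (fun j => Pi.single j 1) i), .ofAdd 1⟩

theorem magnus_right (g : PunctDiskGroup) : (magnus g).right = expSum g := by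
  have : SemidirectProduct.rightHom.comp magnus = expSum := by
    ext i; simp [magnus, expSum]
  exact DFunLike.congr_fun this g

/-- The vector of Fox derivatives with respect to `y₂` and `y₃`. -/
def foxVector (g : PunctDiskGroup) : Fin 2 → ℤ[T;T⁻¹] := (magnus g).left.toAdd

theorem foxVector_mul (g h : PunctDiskGroup) :
    foxVector (g * h) = foxVector g +
      (LaurentPolynomial.T (expSum g).toAdd : ℤ[T;T⁻¹]) • foxVector h := by
  rw [foxVector, map_mul, SemidirectProduct.mul_left, magnus_right]
  rfl

theorem foxVector_one : foxVector 1 = 0 := by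
  rw [foxVector, map_one]; rfl

theorem foxVector_of (i : Fin 3) :
    foxVector (.of i) = Fin.cases 0 (fun j => Pi.single j 1) i := by
  rw [foxVector, magnus, FreeGroup.lift_apply_of]; rfl

theorem foxVector_of_zero_zpow (n : ℤ) : foxVector ((FreeGroup.of 0) ^ n) = 0 := by
  have h : ∀ n : ℤ, foxVector ((FreeGroup.of 0) ^ (n + 1)) = foxVector ((FreeGroup.of 0) ^ n) := by
    intro n
    rw [zpow_add_one, foxVector_mul, foxVector_of, Fin.cases_zero, smul_zero, add_zero]
  induction n with
  | zero => rw [zpow_zero, foxVector_one]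
  | succ n ih => rw [h, ih]
  | pred n ih => rw [← h, sub_add_cancel, ih]

/-- The additive map on the homology of the cover induced by the Fox derivatives. -/
def foxAddHom : CoverHomology →+ (Fin 2 → ℤ[T;T⁻¹]) :=
  MonoidHom.toAdditiveLeft (Abelianization.lift
    { toFun := fun x : coverGroup => Multiplicative.ofAdd (foxVector x)
      map_one' := by rw [Subgroup.coe_one, foxVector_one]; rfl
      map_mul' := fun x y => by
        have hx : expSum (x : PunctDiskGroup) = 1 := x.2
        rw [Subgroup.coe_mul, foxVector_mul, hx, toAdd_one, LaurentPolynomial.T_zero, one_smul]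
        rfl })

theorem foxAddHom_homologyClass (x : coverGroup) : foxAddHom (homologyClass x) = foxVector x :=
  rfl

/-- The Fox vector of `y₁ⁿ` is zero, so conjugating by `y₁ⁿ` only multiplies the vector by `tⁿ`. -/
theorem foxAddHom_T_smul (n : ℤ) (x : CoverHomology) :
    foxAddHom ((LaurentPolynomial.T n : ℤ[T;T⁻¹]) • x) =
      (LaurentPolynomial.T n : ℤ[T;T⁻¹]) • foxAddHom x := by
  obtain ⟨x, rfl⟩ := homologyClass_surjective x
  have hx : expSum (x : PunctDiskGroup) = 1 := x.2
  rw [T_smul, deckAction_homologyClass, foxAddHom_homologyClass, foxAddHom_homologyClass,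
    MulAut.conjNormal_apply, foxVector_mul, foxVector_mul, foxVector_of_zero_zpow, ← zpow_neg,
    foxVector_of_zero_zpow, smul_zero, add_zero, zero_add, map_zpow, expSum_of, ← ofAdd_zsmul]
  simp

/-- The linear map on the homology of the cover induced by the Fox derivatives. -/
def foxLinearMap : CoverHomology →ₗ[ℤ[T;T⁻¹]] (Fin 2 → ℤ[T;T⁻¹]) where
  toFun := foxAddHom
  map_add' := map_add _
  map_smul' p x := by
    rw [RingHom.id_apply]
    induction p using LaurentPolynomial.induction_on' with
    | add p q hp hq => rw [add_smul, add_smul, map_add, hp, hq]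
    | C_mul_T n a =>
      have hC : (LaurentPolynomial.C a : ℤ[T;T⁻¹]) = ((a : ℤ) : ℤ[T;T⁻¹]) := by simp
      rw [mul_smul, mul_smul, hC, Int.cast_smul_eq_zsmul, Int.cast_smul_eq_zsmul,
        map_zsmul, foxAddHom_T_smul]

theorem foxLinearMap_loopClass (i : Fin 2) : foxLinearMap (loopClass i) = Pi.single i 1 := by
  change foxVector (.of i.succ * _) = _
  rw [foxVector_mul, ← zpow_neg, foxVector_of_zero_zpow, smul_zero, add_zero, foxVector_of,
    Fin.cases_succ]

/-- The Fox map carries the loop classes to the standard basis. -/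
theorem linearIndependent_loopClass : LinearIndependent ℤ[T;T⁻¹] loopClass := by
  apply LinearIndependent.of_comp foxLinearMap
  convert (Pi.basisFun ℤ[T;T⁻¹] (Fin 2)).linearIndependent using 1
  ext1 i
  simp [foxLinearMap_loopClass]

/-- The basis `[y₂ y₁⁻¹], [y₃ y₁⁻¹]` of the homology of the cover. -/
def loopBasis : Module.Basis (Fin 2) ℤ[T;T⁻¹] CoverHomology :=
  .mk linearIndependent_loopClass span_loopClass.ge

@[simp] theorem loopBasis_apply (i : Fin 2) : loopBasis i = loopClass i := by
  simp [loopBasis]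

/-! ### The Burau matrices of the full twist and of `σ₁` -/

theorem reducedBurau_homologyClass (β : B3) (x : coverGroup) :
    reducedBurau β (homologyClass x) = homologyClass (liftToCover β x) := rfl

/-- The full twist rotates the disk once, which is conjugation by the boundary loop; it suffices to
compare generators. -/
theorem artinAction_Δ_sq (g : PunctDiskGroup) :
    artinAction (B3.Δ ^ 2) g =
      .of 2 * .of 1 * .of 0 * g * (.of 2 * .of 1 * .of 0)⁻¹ := by
  have h : (artinAction (B3.Δ ^ 2)).toMonoidHom =
      (MulAut.conj (FreeGroup.of 2 * .of 1 * .of 0 : PunctDiskGroup)).toMonoidHom := by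
    ext i
    fin_cases i <;>
      simp [artinAction, B3.Δ, pow_two, artinσ₁, artinσ₂, mul_assoc]
  exact DFunLike.congr_fun h g

theorem reducedBurau_Δ_sq : reducedBurau (B3.Δ ^ 2) = (LaurentPolynomial.T 3 : ℤ[T;T⁻¹]) • 1 := by
  ext x
  obtain ⟨x, rfl⟩ := homologyClass_surjective x
  rw [reducedBurau_homologyClass, LinearMap.smul_apply, Module.End.one_apply]
  have h := homologyClass_conjNormal (.of 2 * .of 1 * .of 0) x
  simp only [map_mul, expSum_of, toAdd_mul, toAdd_ofAdd] at h
  rw [show (3 : ℤ) = 1 + 1 + 1 by norm_num, ← h]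
  congr 1
  apply Subtype.ext
  rw [coe_liftToCover, artinAction_Δ_sq]
  simp [mul_assoc]

theorem reducedBurau_Δ_zpow (k : ℤ) :
    reducedBurau (B3.Δ ^ (2 * k)) = (LaurentPolynomial.T (3 * k) : ℤ[T;T⁻¹]) • 1 := by
  have h : ∀ k : ℤ, reducedBurau (B3.Δ ^ (2 * (k + 1))) =
      (LaurentPolynomial.T 3 : ℤ[T;T⁻¹]) • reducedBurau (B3.Δ ^ (2 * k)) := by
    intro k
    have : B3.Δ ^ (2 * (k + 1)) = B3.Δ ^ 2 * B3.Δ ^ (2 * k) := by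
      rw [mul_add, add_comm, zpow_add]; rfl
    rw [this, map_mul, reducedBurau_Δ_sq, smul_mul_assoc, one_mul]
  induction k with
  | zero => simp
  | succ k ih =>
    rw [h, ih, smul_smul, ← LaurentPolynomial.T_add]; congr 2; ring
  | pred k ih =>
    have := h (-k - 1)
    rw [sub_add_cancel, ih] at this
    -- Cancel the unit `t³` to descend from `-k` to `-k - 1`.
    have h2 := congrArg ((LaurentPolynomial.T (-3) : ℤ[T;T⁻¹]) • ·) this
    simp only [smul_smul, ← LaurentPolynomial.T_add, neg_add_cancel, LaurentPolynomial.T_zero,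
      one_smul] at h2
    rw [← h2]; congr 2; ring

/-- The images of `yᵢ` and `y₁` both have exponent sum 1, so the cocycle rule turns the class of
their quotient into a plain difference. -/
theorem reducedBurau_loopClass (β : B3) (i : Fin 2) :
    reducedBurau β (loopClass i) =
      crossedClass (artinAction β (.of i.succ)) - crossedClass (artinAction β (.of 0)) := by
  rw [loopClass, crossedClass, reducedBurau_homologyClass, ← crossedClass_coe, coe_liftToCover]
  simp only [normalizedLoop, expSum_of, toAdd_ofAdd, zpow_one]
  rw [map_mul, map_inv, crossedClass_mul, crossedClass_inv, expSum_artinAction,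
    expSum_artinAction, expSum_of, expSum_of, smul_neg, smul_smul, ← LaurentPolynomial.T_add,
    add_neg_cancel, LaurentPolynomial.T_zero, one_smul, sub_eq_add_neg]

theorem artinAction_σ₁ : artinAction B3.σ₁ = artinσ₁ := by
  rw [artinAction, B3.lift_σ₁]

theorem reducedBurau_σ₁_loopClass_zero :
    reducedBurau B3.σ₁ (loopClass 0) = (-LaurentPolynomial.T 1 : ℤ[T;T⁻¹]) • loopClass 0 := by
  have h0 : artinσ₁ (.of 0) = .of 1 := by simp [artinσ₁]
  have h1 : artinσ₁ (.of 1) = .of 1 * .of 0 * (.of 1)⁻¹ := by simp [artinσ₁]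
  rw [reducedBurau_loopClass, artinAction_σ₁, Fin.succ_zero_eq_one, h0, h1, crossedClass_mul,
    crossedClass_mul, crossedClass_of_zero, crossedClass_inv, map_mul, expSum_of, expSum_of,
    smul_zero, add_zero, smul_neg, smul_smul, ← LaurentPolynomial.T_add, add_sub_cancel_left,
    neg_smul]
  rfl

theorem reducedBurau_σ₁_loopClass_one :
    reducedBurau B3.σ₁ (loopClass 1) = loopClass 1 - loopClass 0 := by
  have h0 : artinσ₁ (.of 0) = .of 1 := by simp [artinσ₁]
  have h2 : artinσ₁ (.of 2) = .of 2 := by simp [artinσ₁]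
  rw [reducedBurau_loopClass, artinAction_σ₁, Fin.succ_one_eq_two, h0, h2]
  rfl

theorem reducedBurau_inv_apply (β : B3) (x : CoverHomology) :
    reducedBurau β⁻¹ (reducedBurau β x) = x := by
  rw [← Module.End.mul_apply, ← map_mul, inv_mul_cancel, map_one, Module.End.one_apply]

/-! ### Powers of `σ₁` and the trace -/

/-- The unit `-t` of the ring of Laurent polynomials. -/
def negT : ℤ[T;T⁻¹]ˣ where
  val := -LaurentPolynomial.T 1
  inv := -LaurentPolynomial.T (-1)
  val_inv := by rw [neg_mul_neg, ← LaurentPolynomial.T_add]; simp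
  inv_val := by rw [neg_mul_neg, ← LaurentPolynomial.T_add]; simp

theorem negT_zpow (m : ℤ) : ((negT ^ m : ℤ[T;T⁻¹]ˣ) : ℤ[T;T⁻¹]) =
    (((-1) ^ m : ℤ[T;T⁻¹]ˣ) : ℤ[T;T⁻¹]) * LaurentPolynomial.T m := by
  have h (m : ℤ) : ((negT ^ (m + 1) : ℤ[T;T⁻¹]ˣ) : ℤ[T;T⁻¹]) =
      -(((negT ^ m : ℤ[T;T⁻¹]ˣ) : ℤ[T;T⁻¹]) * LaurentPolynomial.T 1) := by
    rw [zpow_add_one, Units.val_mul, ← mul_neg]; rfl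
  induction m with
  | zero => simp
  | succ m ih =>
    rw [h, ih, zpow_add_one, LaurentPolynomial.T_add, Units.val_mul, Units.val_neg, Units.val_one]
    ring
  | pred m ih =>
    have hv : ((negT⁻¹ : ℤ[T;T⁻¹]ˣ) : ℤ[T;T⁻¹]) = -LaurentPolynomial.T (-1) := rfl
    rw [zpow_sub_one, Units.val_mul, ih, hv, zpow_sub_one, sub_eq_add_neg (-(m : ℤ)) 1,
      LaurentPolynomial.T_add, inv_neg, inv_one, Units.val_mul, Units.val_neg, Units.val_one]
    ring

theorem reducedBurau_σ₁_zpow_loopClass_zero (m : ℤ) :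
    reducedBurau (B3.σ₁ ^ m) (loopClass 0) = (negT ^ m : ℤ[T;T⁻¹]ˣ) • loopClass 0 := by
  have h1 : reducedBurau B3.σ₁ (loopClass 0) = negT • loopClass 0 :=
    reducedBurau_σ₁_loopClass_zero
  have h2 : reducedBurau B3.σ₁⁻¹ (loopClass 0) = negT⁻¹ • loopClass 0 := by
    have := reducedBurau_inv_apply B3.σ₁ (loopClass 0)
    rw [h1, Units.smul_def, map_smul, ← Units.smul_def] at this
    exact eq_inv_smul_iff.2 this
  induction m with
  | zero => simp
  | succ m ih =>
    rw [zpow_add_one, map_mul, Module.End.mul_apply, h1, Units.smul_def, map_smul,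
      ← Units.smul_def, ih, smul_smul, zpow_add_one, mul_comm]
  | pred m ih =>
    rw [zpow_sub_one, map_mul, Module.End.mul_apply, h2, Units.smul_def, map_smul,
      ← Units.smul_def, ih, smul_smul, zpow_sub_one, mul_comm]

/-- The coefficient `c` is off the diagonal and never reaches the trace, so it stays unspecified. -/
theorem reducedBurau_σ₁_zpow_loopClass_one (m : ℤ) :
    ∃ c : ℤ[T;T⁻¹], reducedBurau (B3.σ₁ ^ m) (loopClass 1) = loopClass 1 + c • loopClass 0 := by
  have h2 : reducedBurau B3.σ₁⁻¹ (loopClass 1) =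
      loopClass 1 + reducedBurau B3.σ₁⁻¹ (loopClass 0) := by
    have := reducedBurau_inv_apply B3.σ₁ (loopClass 1)
    rw [reducedBurau_σ₁_loopClass_one, map_sub] at this
    exact sub_eq_iff_eq_add.1 this
  induction m with
  | zero => exact ⟨0, by simp⟩
  | succ m ih =>
    obtain ⟨c, hc⟩ := ih
    refine ⟨c - ((negT ^ (m : ℤ) : ℤ[T;T⁻¹]ˣ) : ℤ[T;T⁻¹]), ?_⟩
    rw [zpow_add_one, map_mul, Module.End.mul_apply, reducedBurau_σ₁_loopClass_one, map_sub, hc,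
      reducedBurau_σ₁_zpow_loopClass_zero, sub_smul, ← Units.smul_def, add_sub_assoc]
  | pred m ih =>
    obtain ⟨c, hc⟩ := ih
    refine ⟨c + ((negT ^ (-(m : ℤ) - 1) : ℤ[T;T⁻¹]ˣ) : ℤ[T;T⁻¹]), ?_⟩
    rw [zpow_sub_one, map_mul, Module.End.mul_apply, h2, map_add, hc, ← Module.End.mul_apply,
      ← map_mul, ← zpow_sub_one, reducedBurau_σ₁_zpow_loopClass_zero, add_smul,
      ← Units.smul_def, add_assoc]

theorem trace_reducedBurau_σ₁_zpow (m : ℤ) :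
    LinearMap.trace ℤ[T;T⁻¹] CoverHomology (reducedBurau (B3.σ₁ ^ m)) =
      1 + (((-1) ^ m : ℤ[T;T⁻¹]ˣ) : ℤ[T;T⁻¹]) * LaurentPolynomial.T m := by
  obtain ⟨c, hc⟩ := reducedBurau_σ₁_zpow_loopClass_one m
  rw [LinearMap.trace_eq_matrix_trace _ loopBasis, Matrix.trace_fin_two, LinearMap.toMatrix_apply,
    LinearMap.toMatrix_apply, loopBasis_apply, loopBasis_apply, hc,
    reducedBurau_σ₁_zpow_loopClass_zero, Units.smul_def, ← loopBasis_apply, ← loopBasis_apply,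
    ← negT_zpow]
  simp [-loopBasis_apply, add_comm]

theorem trace_reducedBurau_conj (k m : ℤ) (τ : B3) :
    LinearMap.trace ℤ[T;T⁻¹] CoverHomology
        (reducedBurau (B3.Δ ^ (2 * k) * τ * B3.σ₁ ^ m * τ⁻¹)) =
      LaurentPolynomial.T (3 * k) +
        (((-1) ^ m : ℤ[T;T⁻¹]ˣ) : ℤ[T;T⁻¹]) * LaurentPolynomial.T (3 * k + m) := by
  rw [mul_assoc, mul_assoc, map_mul, reducedBurau_Δ_zpow, smul_mul_assoc, one_mul, map_smul,
    map_mul, LinearMap.trace_mul_comm, ← map_mul, inv_mul_cancel_right,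
    trace_reducedBurau_σ₁_zpow, LaurentPolynomial.T_add, smul_eq_mul]
  ring

end

theorem mainTheorem7 (β : B3) (hβ : IsReducibleBraid β) :
    (∃ (k m : ℤ) (τ : B3), β = B3.Δ ^ (2 * k) * τ * B3.σ₁ ^ m * τ⁻¹) ∧
    Nonempty (Module.Basis (Fin 2) ℤ[T;T⁻¹] CoverHomology) ∧
    ∀ (b : Module.Basis (Fin 2) ℤ[T;T⁻¹] CoverHomology) (k m : ℤ) (τ : B3),
      β = B3.Δ ^ (2 * k) * τ * B3.σ₁ ^ m * τ⁻¹ →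
        (reducedBurauMatrix b β).trace =
          LaurentPolynomial.T (3 * k) +
            (((-1) ^ m : ℤ[T;T⁻¹]ˣ) : ℤ[T;T⁻¹]) * LaurentPolynomial.T (3 * k + m) := by
  refine ⟨B3.exists_eq_of_isReducible hβ, ⟨loopBasis⟩, ?_⟩
  rintro b k m τ rfl
  -- The trace of the endomorphism does not depend on `b`, so the computation in `loopBasis`
  -- applies.
  rw [reducedBurauMatrix, ← LinearMap.trace_eq_matrix_trace, trace_reducedBurau_conj]
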